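/- Let $h:\mathbb{R}_{\ge 0}\to\mathbb{R}_{\ge 0}$ be strictly increasing with $h(0)=0$ and $h(n)\in\mathbb{Z}$ for every integer $n\ge 0$. For $n\ge 0$ let $p_h(n)$ be the number of partitions of $n$ all of whose parts belong to $\{h(i) : i\in\mathbb{Z},\ i\ge 1\}$, i.e. $\sum_{n\ge 0}p_h(n)z^n=\prod_{i\ge 1}(1-z^{h(i)})^{-1}$. Let $N$ be a positive integer, and for $\Re s>0$ put $$w'_k(s)=\int_0^\infty e^{-skh(x)}\,dx\quad(k\ge 1),\qquad \lambda(s)=\sum_{k=1}^{N}\frac{w'_k(s)}{k}.$$ Let $c>0$ and suppose that there are $\alpha,D>0$ such that $|w'_1(s)|\le D|s|^{-\alpha}$ for all $s\in\mathbb{C}$ with $\Re s=c$. Then for all $x>0$ and all $c'>0$ the limit $$\varphi_h(x)=\frac{1}{2\pi i}\lim_{T\to\infty}\int_{c'-iT}^{c'+iT}\frac{1}{s}\exp(\lambda(s))\,e^{xs}\,ds$$ exists, is a real number, and does not depend on $c'$; moreover $$e^{-1}N^{-1}\varphi_h(N)\le\sum_{n=0}^{N}p_h(n)\le\varphi_h(N).$$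 -/

import Mathlib

noncomputable section

open scoped Classical in
/-- `p_h(n)`: the number of partitions of `n` all of whose parts belong to
`{h(i) | i ∈ ℤ, i ≥ 1}`. -/
def partitionCount (h : ℝ → ℝ) (n : ℕ) : ℕ :=
  (Nat.Partition.restricted n (fun m => ∃ i : ℕ, 1 ≤ i ∧ h i = (m : ℝ))).card

/-- `w'_k(s) = ∫_0^∞ e^{-s k h(x)} dx`. -/
def wPrime (h : ℝ → ℝ) (k : ℕ) (s : ℂ) : ℂ :=
  ∫ x in Set.Ioi (0 : ℝ), Complex.exp (-s * k * (h x : ℂ))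

/-- `λ(s) = ∑_{k=1}^N w'_k(s) / k`. -/
def lambdaSum (h : ℝ → ℝ) (N : ℕ) (s : ℂ) : ℂ :=
  ∑ k ∈ Finset.Icc 1 N, wPrime h k s / k

/-- `∫_{c-iT}^{c+iT} F(s) ds` along the vertical segment, parametrized by `s = c + it`. -/
def verticalIntegral (F : ℂ → ℂ) (c T : ℝ) : ℂ :=
  ∫ t in (-T)..T, F (c + t * Complex.I) * Complex.I

/-- The truncated Bromwich integral `(1/2πi) ∫_{c-iT}^{c+iT} s⁻¹ exp(λ(s)) e^{xs} ds`. -/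
def bromwichTrunc (h : ℝ → ℝ) (N : ℕ) (c x T : ℝ) : ℂ :=
  1 / (2 * Real.pi * Complex.I) *
    verticalIntegral (fun s => 1 / s * Complex.exp (lambdaSum h N s) * Complex.exp (x * s)) c T

end

/-! `lambdaSum` is the Laplace transform of a positive measure `μ = stepMeasure h N` on the
half-line, so `exp λ` is the Laplace transform of its convolution exponential `convExp μ = ∑ μ^{*j}
/ j!`. Dividing by `s` and inverting recovers the distribution function
(`tendsto_verticalIntegral_laplace`): `φ x` is the mass that `convExp μ` gives to `Iic x`. It is
real and free of `c'`, and every `x > 0` is admissible because the only atom of `convExp μ` is at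
`0`.

By the Euler product, the partition-counting measure is also a convolution exponential, of `ν = ∑_m
∑_k (1/k) δ_{km}` over the admissible parts `m` (`convExp_logMeasure`). For `t ≤ N`, the number of
`i ≥ 1` with `h i ≤ t` and the length of `{x > 0 | h x ≤ t}` differ by at most one. Taking `t = y /
k` with weights `1 / k` gives `ν ≤ μ ≤ ν + H_N δ_0` for distribution functions on `Iic N`, where
`H_N` is the harmonic sum (`stepMeasure_Iic_bounds`).

The convolution exponential preserves this order (`convExp_Iic_mono`), and the extra mass `H_N` at
`0` only multiplies it by `exp H_N ≤ e N` (`convExp_add_dirac`). Both inequalities follow. -/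

open MeasureTheory Filter Set
open scoped Topology ENNReal

/-! ### The sine integral -/

/-- The sine integral `∫_0^v sinc`. -/
noncomputable def sineIntegral (v : ℝ) : ℝ := ∫ x in (0 : ℝ)..v, Real.sinc x

theorem hasDerivAt_sineIntegral (v : ℝ) : HasDerivAt sineIntegral (Real.sinc v) v :=
  Real.continuous_sinc.integral_hasStrictDerivAt 0 v |>.hasDerivAt

theorem continuous_sineIntegral : Continuous sineIntegral :=
  continuous_iff_continuousAt.2 fun v => (hasDerivAt_sineIntegral v).continuousAt

theorem sineIntegral_neg (v : ℝ) : sineIntegral (-v) = -sineIntegral v := by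
  have h := intervalIntegral.integral_comp_neg (a := 0) (b := v) (f := Real.sinc)
  simp only [Real.sinc_neg, neg_zero] at h
  rw [sineIntegral, sineIntegral, h, intervalIntegral.integral_symm]

/-- Integration by parts: `sineIntegral x + cos x / x` has derivative `-cos x / x ^ 2`, which is
integrable at infinity. The value of the limit is found later, in `tendsto_sineIntegral`. -/
theorem exists_tendsto_sineIntegral : ∃ l, Tendsto sineIntegral atTop (𝓝 l) := by
  have hint : IntegrableOn (fun x : ℝ => -Real.cos x / x ^ 2) (Ioi 1) := by
    have h := integrableOn_Ioi_rpow_of_lt (a := -2) (by norm_num) (zero_lt_one (α := ℝ))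
    refine Integrable.mono' h (Measurable.aestronglyMeasurable (by fun_prop)) ?_
    refine (ae_restrict_iff' measurableSet_Ioi).2 (ae_of_all _ fun x hx => ?_)
    have hx0 : (0 : ℝ) < x := lt_trans zero_lt_one hx
    rw [norm_div, norm_neg, Real.norm_eq_abs, Real.norm_eq_abs, abs_of_pos (pow_pos hx0 2),
      Real.rpow_neg hx0.le, div_eq_mul_inv]
    norm_cast
    exact mul_le_of_le_one_left (by positivity) (Real.abs_cos_le_one x)
  have hlim := intervalIntegral_tendsto_integral_Ioi 1 hint tendsto_id
  have hcos : Tendsto (fun v : ℝ => Real.cos v / v) atTop (𝓝 0) := by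
    refine squeeze_zero_norm' ?_ tendsto_inv_atTop_zero
    filter_upwards [eventually_gt_atTop 0] with v hv
    rw [norm_div, Real.norm_eq_abs, Real.norm_eq_abs, abs_of_pos hv, div_eq_mul_inv]
    exact mul_le_of_le_one_left (by positivity) (Real.abs_cos_le_one v)
  have key : ∀ v : ℝ, 1 ≤ v → ∫ x in (1 : ℝ)..v, -Real.cos x / x ^ 2 =
      (sineIntegral v + Real.cos v / v) - (sineIntegral 1 + Real.cos 1 / 1) := by
    intro v hv
    refine intervalIntegral.integral_eq_sub_of_hasDerivAt
      (f := fun x => sineIntegral x + Real.cos x / x) ?_ ?_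
    · intro x hx
      rw [uIcc_of_le hv] at hx
      have hx0 : x ≠ 0 := (lt_of_lt_of_le zero_lt_one hx.1).ne'
      refine ((hasDerivAt_sineIntegral x).add
        ((Real.hasDerivAt_cos x).div (hasDerivAt_id x) hx0)).congr_deriv ?_
      rw [Real.sinc_of_ne_zero hx0]
      simp only [id]
      field_simp
      ring
    · rw [intervalIntegrable_iff_integrableOn_Ioc_of_le hv]
      exact hint.mono_set Ioc_subset_Ioi_self
  refine ⟨_, ((hlim.add_const (sineIntegral 1 + Real.cos 1 / 1)).sub hcos).congr' ?_⟩
  filter_upwards [eventually_ge_atTop 1] with v hv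
  simp only [id]
  rw [key v hv]
  ring

theorem exists_abs_sineIntegral_le : ∃ C, 0 < C ∧ ∀ v, |sineIntegral v| ≤ C := by
  obtain ⟨l, hl⟩ := exists_tendsto_sineIntegral
  obtain ⟨V, hV⟩ := eventually_atTop.1 (hl.abs.eventually (gt_mem_nhds (lt_add_one |l|)))
  obtain ⟨B, hB⟩ := (isCompact_Icc (a := 0) (b := V)).exists_bound_of_continuousOn
    continuous_sineIntegral.continuousOn
  have hpos : ∀ v, 0 ≤ v → |sineIntegral v| ≤ max B (|l| + 1) := by
    intro v hv
    rcases le_total V v with h | h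
    · exact (hV v h).le.trans (le_max_right _ _)
    · exact (hB v ⟨hv, h⟩).trans (le_max_left _ _)
  refine ⟨max B (|l| + 1), lt_max_of_lt_right (by positivity), fun v => ?_⟩
  rcases le_total 0 v with h | h
  · exact hpos v h
  · have := hpos (-v) (by linarith)
    rwa [sineIntegral_neg, abs_neg] at this

/-! ### The truncated inversion kernel of `1 / s` -/

theorem integral_exp_mul_I_eq_sinc_mul (T b : ℝ) :
    ∫ t in (-T)..T, Complex.exp (t * b * Complex.I) = ((2 * T * Real.sinc (T * b) : ℝ) : ℂ) := by
  rcases eq_or_ne b 0 with rfl | hb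
  · simp [two_mul]
  · have h := intervalIntegral.integral_comp_mul_right (a := -T) (b := T)
      (fun t : ℝ => Complex.exp (t * Complex.I)) hb
    push_cast at h
    rw [h, neg_mul, integral_exp_mul_I_eq_sinc, Complex.real_smul]
    have : (b : ℂ) ≠ 0 := by exact_mod_cast hb
    push_cast
    field_simp

/-- The truncated inverse Laplace kernel of `1 / s`, up to the factor `exp (c * y) / (2 * π)`. -/
noncomputable def inversionKernel (c T y : ℝ) : ℝ :=
  2 * sineIntegral (T * y) - 2 * ∫ a in Ioi (0 : ℝ), c * Real.exp (-c * a) * sineIntegral (T * (y - a))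

theorem integrableOn_exp_mul_sineIntegral {c : ℝ} (hc : 0 < c) (T y : ℝ) :
    IntegrableOn (fun a => c * Real.exp (-c * a) * sineIntegral (T * (y - a))) (Ioi 0) := by
  obtain ⟨C, -, hC⟩ := exists_abs_sineIntegral_le
  have hcont : Continuous fun a => sineIntegral (T * (y - a)) :=
    continuous_sineIntegral.comp (by fun_prop)
  exact ((exp_neg_integrableOn_Ioi 0 hc).const_mul c).mul_bdd (c := C) hcont.aestronglyMeasurable
    (ae_of_all _ fun a => hC _)

/-- Integration by parts trades the sinc, whose factor `T` is unbounded, for sine integrals, which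
are bounded uniformly in `T`. -/
theorem integral_exp_mul_sinc {c : ℝ} (hc : 0 < c) (T y : ℝ) :
    ∫ a in Ioi (0 : ℝ), Real.exp (-c * a) * (2 * T * Real.sinc (T * (y - a))) =
      inversionKernel c T y := by
  obtain ⟨C, -, hC⟩ := exists_abs_sineIntegral_le
  have hexp : Tendsto (fun a : ℝ => Real.exp (-c * a)) atTop (𝓝 0) := by
    simpa using tendsto_const_nhds.neg_mul_atTop (neg_lt_zero.2 hc) tendsto_id
  have hcont : Continuous fun a => sineIntegral (T * (y - a)) :=
    continuous_sineIntegral.comp (by fun_prop)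
  have h := integral_Ioi_mul_deriv_eq_deriv_mul (a := 0)
    (u := fun a => Real.exp (-c * a)) (u' := fun a => Real.exp (-c * a) * (-c))
    (v := fun a => -2 * sineIntegral (T * (y - a)))
    (v' := fun a => 2 * T * Real.sinc (T * (y - a)))
    (a' := -2 * sineIntegral (T * y)) (b' := 0) ?_ ?_ ?_ ?_ ?_ ?_
  · rw [h, inversionKernel, ← integral_const_mul, zero_sub]
    congr 1
    · ring
    · refine integral_congr_ae (ae_of_all _ fun a => ?_)
      simp only
      ring
  · intro a _
    simpa using ((hasDerivAt_id a).const_mul (-c)).exp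
  · intro a _
    have h1 : HasDerivAt (fun a => T * (y - a)) (T * -1) a :=
      ((hasDerivAt_id a).const_sub y).const_mul T
    refine (((hasDerivAt_sineIntegral _).comp a h1).const_mul (-2)).congr_deriv ?_
    ring
  · have hsinc : Continuous fun a => 2 * T * Real.sinc (T * (y - a)) :=
      continuous_const.mul (Real.continuous_sinc.comp (by fun_prop))
    refine (exp_neg_integrableOn_Ioi 0 hc).mul_bdd (c := 2 * |T|) hsinc.aestronglyMeasurable
      (ae_of_all _ fun a => ?_)
    rw [norm_mul, norm_mul, Real.norm_eq_abs, Real.norm_eq_abs, Real.norm_eq_abs]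
    have := Real.abs_sinc_le_one (T * (y - a))
    rw [abs_two]
    exact mul_le_of_le_one_right (by positivity) this
  · refine ((integrableOn_exp_mul_sineIntegral hc T y).const_mul 2).congr (ae_of_all _ fun a => ?_)
    simp only [Pi.mul_apply]
    ring
  · have : Continuous ((fun a => Real.exp (-c * a)) * fun a => -2 * sineIntegral (T * (y - a))) :=
      Continuous.mul (by fun_prop) (continuous_const.mul hcont)
    have h0 := (this.tendsto 0).mono_left (nhdsWithin_le_nhds (s := Ioi 0))
    simpa using h0
  · have := bdd_le_mul_tendsto_zero' (2 * C) (f := fun a => -2 * sineIntegral (T * (y - a)))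
      (Eventually.of_forall fun a => ?_) hexp
    · exact this.congr fun a => mul_comm _ _
    · rw [abs_mul, abs_neg, abs_two]
      exact mul_le_mul_of_nonneg_left (hC _) (by norm_num)

/-- Write `1 / (c + it)` as the integral of `exp (-(c + it) a)` over `a > 0` and exchange the
integrals; the inner one over `t` is a sinc. -/
theorem integral_exp_div_eq_inversionKernel {c : ℝ} (hc : 0 < c) {T : ℝ} (hT : 0 < T) (y : ℝ) :
    ∫ t in (-T)..T, Complex.exp (t * y * Complex.I) / (c + t * Complex.I) =
      (inversionKernel c T y : ℂ) := by
  have hle : -T ≤ T := by linarith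
  have hinner : ∀ t : ℝ, Complex.exp (t * y * Complex.I) / (c + t * Complex.I) =
      ∫ a in Ioi (0 : ℝ), Complex.exp (-c * a) * Complex.exp (t * (y - a : ℝ) * Complex.I) := by
    intro t
    have h := integral_exp_mul_complex_Ioi (a := -(c + t * Complex.I)) (by simpa using hc) 0
    rw [Complex.ofReal_zero, mul_zero, Complex.exp_zero, neg_div_neg_eq] at h
    rw [div_eq_mul_one_div, ← h, ← integral_const_mul]
    refine integral_congr_ae (ae_of_all _ fun a => ?_)
    simp only [← Complex.exp_add]
    congr 1
    push_cast
    ring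
  simp_rw [hinner]
  rw [intervalIntegral.integral_of_le hle, integral_integral_swap, ← integral_exp_mul_sinc hc,
    ← integral_complex_ofReal]
  · refine integral_congr_ae (ae_of_all _ fun a => ?_)
    simp only
    rw [integral_const_mul, ← intervalIntegral.integral_of_le hle, integral_exp_mul_I_eq_sinc_mul]
    push_cast
    rfl
  · have h := (exp_neg_integrableOn_Ioi 0 hc).comp_snd (volume.restrict (Ioc (-T) T))
    refine Integrable.mono' h ?_ (ae_of_all _ fun p => ?_)
    · exact Continuous.aestronglyMeasurable (by fun_prop)
    · simp only [Function.uncurry]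
      rw [norm_mul, ← Complex.ofReal_mul, Complex.norm_exp_ofReal_mul_I, mul_one, Complex.norm_exp]
      simp

theorem integral_mul_exp_neg {c : ℝ} (hc : 0 < c) (b : ℝ) :
    ∫ a in Ioi b, c * Real.exp (-c * a) = Real.exp (-c * b) := by
  rw [integral_const_mul, integral_exp_mul_Ioi (neg_lt_zero.2 hc)]
  field_simp

/-- The weight `c * exp (-c * a)` is a probability density on the half-line, so averaging keeps the
bound on the sine integral. Uniformity in `T` and `y` is what dominated convergence needs. -/
theorem exists_abs_inversionKernel_le :
    ∃ C, 0 < C ∧ ∀ c, 0 < c → ∀ T y, |inversionKernel c T y| ≤ C := by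
  obtain ⟨C, hC0, hC⟩ := exists_abs_sineIntegral_le
  refine ⟨4 * C, by positivity, fun c hc T y => ?_⟩
  have h1 : |∫ a in Ioi (0 : ℝ), c * Real.exp (-c * a) * sineIntegral (T * (y - a))| ≤ C := by
    have := norm_integral_le_of_norm_le (μ := volume.restrict (Ioi (0 : ℝ)))
      (f := fun a => c * Real.exp (-c * a) * sineIntegral (T * (y - a)))
      (((exp_neg_integrableOn_Ioi 0 hc).const_mul c).mul_const C) (ae_of_all _ fun a => ?_)
    · rw [integral_mul_const, integral_mul_exp_neg hc] at this
      simpa using this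
    · rw [norm_mul, Real.norm_of_nonneg (by positivity)]
      exact mul_le_mul_of_nonneg_left (hC _) (by positivity)
  rw [inversionKernel]
  refine (abs_sub _ _).trans ?_
  rw [abs_mul, abs_mul, abs_two]
  linarith [hC (T * y)]

theorem continuous_inversionKernel {c : ℝ} (hc : 0 < c) (T : ℝ) :
    Continuous (inversionKernel c T) := by
  obtain ⟨C, -, hC⟩ := exists_abs_sineIntegral_le
  refine (continuous_const.mul (continuous_sineIntegral.comp (by fun_prop))).sub
    (continuous_const.mul ?_)
  refine continuous_of_dominated (bound := fun a => c * Real.exp (-c * a) * C)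
    (fun y => (integrableOn_exp_mul_sineIntegral hc T y).aestronglyMeasurable)
    (fun y => ae_of_all _ fun a => ?_)
    (((exp_neg_integrableOn_Ioi 0 hc).const_mul c).mul_const C)
    (ae_of_all _ fun a => continuous_const.mul (continuous_sineIntegral.comp (by fun_prop)))
  rw [norm_mul, Real.norm_of_nonneg (by positivity)]
  exact mul_le_mul_of_nonneg_left (hC _) (by positivity)

theorem tendsto_sineIntegral_mul {l : ℝ} (hl : Tendsto sineIntegral atTop (𝓝 l)) (y : ℝ) :
    Tendsto (fun T => sineIntegral (T * y)) atTop (𝓝 (l * SignType.sign y)) := by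
  rcases lt_trichotomy y 0 with hy | rfl | hy
  · have h := (hl.comp (tendsto_id.atTop_mul_const (neg_pos.2 hy))).neg
    simp only [sign_neg hy]
    refine (h.congr fun T => ?_).trans (by simp)
    simp [sineIntegral_neg]
  · simp [sineIntegral]
  · simpa [sign_pos hy, Function.comp_def] using hl.comp (tendsto_id.atTop_mul_const hy)

theorem integral_exp_mul_sign {c : ℝ} (hc : 0 < c) (y : ℝ) :
    ∫ a in Ioi (0 : ℝ), c * Real.exp (-c * a) * (SignType.sign (y - a) : ℝ) =
      if 0 < y then 1 - 2 * Real.exp (-c * y) else -1 := by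
  have hi : ∀ b, IntegrableOn (fun a => c * Real.exp (-c * a)) (Ioi b) :=
    fun b => (exp_neg_integrableOn_Ioi b hc).const_mul c
  have hneg : ∀ b, y ≤ b → ∫ a in Ioi b, c * Real.exp (-c * a) * (SignType.sign (y - a) : ℝ) =
      -Real.exp (-c * b) := by
    intro b hb
    rw [← integral_mul_exp_neg hc, ← integral_neg]
    refine setIntegral_congr_fun measurableSet_Ioi fun a ha => ?_
    rw [sign_neg (by linarith [mem_Ioi.1 ha])]
    simp
  split_ifs with hy
  · have hpos : ∫ a in Ioc 0 y, c * Real.exp (-c * a) * (SignType.sign (y - a) : ℝ) =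
        1 - Real.exp (-c * y) := by
      have h1 : ∫ a in Ioc 0 y, c * Real.exp (-c * a) * (SignType.sign (y - a) : ℝ) =
          ∫ a in Ioc 0 y, c * Real.exp (-c * a) := by
        rw [integral_Ioc_eq_integral_Ioo, integral_Ioc_eq_integral_Ioo]
        refine setIntegral_congr_fun measurableSet_Ioo fun a ha => ?_
        rw [sign_pos (by linarith [ha.2])]
        simp
      have h2 := integral_mul_exp_neg hc 0
      rw [← Ioc_union_Ioi_eq_Ioi hy.le, setIntegral_union Ioc_disjoint_Ioi_same measurableSet_Ioi
        ((hi 0).mono_set Ioc_subset_Ioi_self) (hi y), integral_mul_exp_neg hc] at h2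
      rw [h1]
      simp only [mul_zero, Real.exp_zero] at h2
      linarith
    have hint : IntegrableOn (fun a => c * Real.exp (-c * a) * (SignType.sign (y - a) : ℝ))
        (Ioi 0) := by
      refine (hi 0).mul_bdd (c := 1) ?_ (ae_of_all _ fun a => ?_)
      · refine Measurable.aestronglyMeasurable (Antitone.measurable fun a b hab => ?_)
        have h : SignType.sign (y - b) ≤ SignType.sign (y - a) := SignType.sign.monotone (by linarith)
        revert h
        generalize SignType.sign (y - b) = p
        generalize SignType.sign (y - a) = q
        rcases p with _ | _ | _ <;> rcases q with _ | _ | _ <;> norm_num; decide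
      · rcases lt_trichotomy (y - a) 0 with h | h | h <;> simp [h, sign_neg, sign_pos]
    rw [← Ioc_union_Ioi_eq_Ioi hy.le, setIntegral_union Ioc_disjoint_Ioi_same measurableSet_Ioi
      (hint.mono_set Ioc_subset_Ioi_self) (hint.mono_set (Ioi_subset_Ioi hy.le)), hpos,
      hneg y le_rfl]
    ring
  · rw [hneg 0 (not_lt.1 hy)]
    simp

theorem tendsto_integral_exp_mul_sineIntegral {l : ℝ} (hl : Tendsto sineIntegral atTop (𝓝 l))
    {c : ℝ} (hc : 0 < c) (y : ℝ) :
    Tendsto (fun T => ∫ a in Ioi (0 : ℝ), c * Real.exp (-c * a) * sineIntegral (T * (y - a)))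
      atTop (𝓝 (l * if 0 < y then 1 - 2 * Real.exp (-c * y) else -1)) := by
  obtain ⟨C, -, hC⟩ := exists_abs_sineIntegral_le
  rw [← integral_exp_mul_sign hc, ← integral_const_mul]
  refine tendsto_integral_filter_of_dominated_convergence (fun a => c * Real.exp (-c * a) * C)
    (Eventually.of_forall fun T =>
      (integrableOn_exp_mul_sineIntegral hc T y).aestronglyMeasurable)
    (Eventually.of_forall fun T => ae_of_all _ fun a => ?_)
    (((exp_neg_integrableOn_Ioi 0 hc).const_mul c).mul_const C) (ae_of_all _ fun a => ?_)
  · rw [norm_mul, Real.norm_of_nonneg (by positivity)]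
    exact mul_le_mul_of_nonneg_left (hC _) (by positivity)
  · refine ((tendsto_sineIntegral_mul hl (y - a)).const_mul _).trans ?_
    rw [mul_left_comm]

/-- At `c = 1`, `y = 0` the real part of the integrand is `1 / (1 + t ^ 2)`. This explicit value
identifies the limit of the sine integral. -/
theorem inversionKernel_one_zero {T : ℝ} (hT : 0 < T) :
    inversionKernel 1 T 0 = 2 * Real.arctan T := by
  have h := integral_exp_div_eq_inversionKernel one_pos hT 0
  have h2 := congrArg Complex.re h
  rw [Complex.ofReal_re] at h2
  rw [← h2, ← Complex.reCLM_apply, ← ContinuousLinearMap.intervalIntegral_comp_comm]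
  · have : ∀ t : ℝ, Complex.reCLM (Complex.exp (t * (0 : ℝ) * Complex.I) /
        ((1 : ℝ) + t * Complex.I)) = 1 / (1 + t ^ 2) := by
      intro t
      simp [Complex.normSq_apply, sq]
    simp_rw [this]
    rw [integral_one_div_one_add_sq, Real.arctan_neg]
    ring
  · refine Continuous.intervalIntegrable ?_ _ _
    refine Continuous.div (by fun_prop) (by fun_prop) fun t ht => ?_
    simpa using congrArg Complex.re ht

theorem tendsto_sineIntegral : Tendsto sineIntegral atTop (𝓝 (Real.pi / 2)) := by
  obtain ⟨l, hl⟩ := exists_tendsto_sineIntegral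
  have h1 : Tendsto (fun T => inversionKernel 1 T 0) atTop (𝓝 (2 * l)) := by
    have := (tendsto_integral_exp_mul_sineIntegral hl one_pos 0).const_mul 2
    simpa [inversionKernel, sineIntegral] using this.neg
  have h2 : Tendsto (fun T => inversionKernel 1 T 0) atTop (𝓝 (2 * (Real.pi / 2))) := by
    refine ((Real.tendsto_arctan_atTop.mono_right nhdsWithin_le_nhds).const_mul 2).congr' ?_
    filter_upwards [eventually_gt_atTop 0] with T hT
    rw [inversionKernel_one_zero hT]
  have := tendsto_nhds_unique h1 h2
  rwa [show Real.pi / 2 = l by linarith]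

/-- At `y = 0` the limit is `π`, half of the jump; this is why inversion is stated at points that
are not atoms. -/
theorem tendsto_inversionKernel {c : ℝ} (hc : 0 < c) {y : ℝ} (hy : y ≠ 0) :
    Tendsto (fun T => inversionKernel c T y) atTop
      (𝓝 (if 0 < y then 2 * Real.pi * Real.exp (-c * y) else 0)) := by
  have h := ((tendsto_sineIntegral_mul tendsto_sineIntegral y).const_mul 2).sub
    ((tendsto_integral_exp_mul_sineIntegral tendsto_sineIntegral hc y).const_mul 2)
  refine h.trans (le_of_eq ?_)
  congr 1
  rcases hy.lt_or_gt with hy | hy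
  · rw [if_neg hy.not_gt, if_neg hy.not_gt, sign_neg hy]
    simp
  · rw [if_pos hy, if_pos hy, sign_pos hy]
    simp only [SignType.coe_one]
    ring

/-! ### Laplace transforms of measures and their inversion -/

/-- The Laplace transform of a measure on the line. -/
noncomputable def laplace (A : Measure ℝ) (s : ℂ) : ℂ := ∫ u, Complex.exp (-s * u) ∂A

theorem norm_exp_neg_mul (s : ℂ) (u : ℝ) :
    ‖Complex.exp (-s * u)‖ = Real.exp (-s.re * u) := by
  rw [Complex.norm_exp]
  simp

/-- Laplace inversion of `laplace A s / s` at a point that is not an atom of `A`. -/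
theorem tendsto_verticalIntegral_laplace (A : Measure ℝ) [SFinite A] {c : ℝ} (hc : 0 < c)
    (hA : Integrable (fun u => Real.exp (-c * u)) A) {x : ℝ} (hx : A {x} = 0) :
    Tendsto (fun T => 1 / (2 * Real.pi * Complex.I) *
      verticalIntegral (fun s => 1 / s * laplace A s * Complex.exp (x * s)) c T) atTop
      (𝓝 ((A.real (Iic x) : ℝ) : ℂ)) := by
  have hne : ∀ t : ℝ, (c : ℂ) + t * Complex.I ≠ 0 := fun t ht => by
    have := congrArg Complex.re ht
    simp at this
    exact hc.ne' this
  have hformula : ∀ T : ℝ, 0 < T → 1 / (2 * Real.pi * Complex.I) *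
      verticalIntegral (fun s => 1 / s * laplace A s * Complex.exp (x * s)) c T =
      ((∫ u, Real.exp (c * (x - u)) / (2 * Real.pi) * inversionKernel c T (x - u) ∂A : ℝ) : ℂ) := by
    intro T hT
    have hle : -T ≤ T := by linarith
    have h1 : ∀ t : ℝ, 1 / ((c : ℂ) + t * Complex.I) * laplace A (c + t * Complex.I) *
        Complex.exp (x * (c + t * Complex.I)) * Complex.I =
        ∫ u, (Real.exp (c * (x - u)) : ℂ) * Complex.I *
          (Complex.exp (t * (x - u : ℝ) * Complex.I) / (c + t * Complex.I)) ∂A := by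
      intro t
      rw [laplace, ← integral_const_mul, ← integral_mul_const, ← integral_mul_const]
      refine integral_congr_ae (ae_of_all _ fun u => ?_)
      simp only
      have : Complex.exp (-(c + t * Complex.I) * u) * Complex.exp (x * (c + t * Complex.I)) =
          (Real.exp (c * (x - u)) : ℂ) * Complex.exp (t * (x - u : ℝ) * Complex.I) := by
        rw [Complex.ofReal_exp, ← Complex.exp_add, ← Complex.exp_add]
        congr 1
        push_cast
        ring
      rw [mul_assoc (1 / ((c : ℂ) + t * Complex.I)), this]
      ring
    rw [verticalIntegral]
    simp_rw [h1]
    rw [intervalIntegral.integral_of_le hle, integral_integral_swap, ← integral_complex_ofReal,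
      ← integral_const_mul]
    · refine integral_congr_ae (ae_of_all _ fun u => ?_)
      simp only
      rw [integral_const_mul, ← intervalIntegral.integral_of_le hle,
        integral_exp_div_eq_inversionKernel hc hT]
      have hI := Complex.I_ne_zero
      have hpi : (Real.pi : ℂ) ≠ 0 := by exact_mod_cast Real.pi_ne_zero
      push_cast
      field_simp
    -- Fubini is justified by `‖c + it‖ ≥ c`.
    · have h := ((hA.const_mul (Real.exp (c * x) / c)).comp_snd (volume.restrict (Ioc (-T) T)))
      refine Integrable.mono' h ?_ (ae_of_all _ fun p => ?_)
      · refine Continuous.aestronglyMeasurable ?_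
        refine Continuous.mul (by fun_prop) (Continuous.div (by fun_prop) (by fun_prop) ?_)
        exact fun p => hne p.1
      · simp only [Function.uncurry]
        rw [norm_mul, norm_mul, norm_div, Complex.norm_I, mul_one, ← Complex.ofReal_mul,
          Complex.norm_exp_ofReal_mul_I, Complex.norm_real, Real.norm_of_nonneg (Real.exp_pos _).le,
          show c * (x - p.2) = c * x + -c * p.2 by ring, Real.exp_add, mul_one_div,
          div_mul_eq_mul_div]
        refine div_le_div_of_nonneg_left (by positivity) hc ?_
        have := Complex.abs_re_le_norm (c + p.1 * Complex.I)
        simpa [abs_of_pos hc] using this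
  have hlim : Tendsto (fun T => ∫ u, Real.exp (c * (x - u)) / (2 * Real.pi) *
      inversionKernel c T (x - u) ∂A) atTop (𝓝 (A.real (Iic x))) := by
    obtain ⟨C, hC0, hC⟩ := exists_abs_inversionKernel_le
    rw [← integral_indicator_one measurableSet_Iic]
    refine tendsto_integral_filter_of_dominated_convergence
      (fun u => Real.exp (c * x) / (2 * Real.pi) * Real.exp (-c * u) * C)
      (Eventually.of_forall fun T => ?_) (Eventually.of_forall fun T => ae_of_all _ fun u => ?_)
      ((hA.const_mul _).mul_const C) ?_
    · refine Continuous.aestronglyMeasurable (Continuous.mul (by fun_prop) ?_)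
      exact (continuous_inversionKernel hc T).comp (by fun_prop)
    · rw [norm_mul, Real.norm_of_nonneg (by positivity),
        show c * (x - u) = c * x + -c * u by ring, Real.exp_add, mul_div_right_comm]
      exact mul_le_mul_of_nonneg_left (hC c hc _ _) (by positivity)
    -- Since `x` is not an atom, the half-jump at `u = x` can be discarded.
    · have hae : ∀ᵐ u ∂A, u ≠ x := by
        rw [ae_iff]
        simpa using hx
      filter_upwards [hae] with u hu
      have h := (tendsto_inversionKernel hc (sub_ne_zero.2 hu.symm)).const_mul
        (Real.exp (c * (x - u)) / (2 * Real.pi))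
      refine h.trans (le_of_eq ?_)
      congr 1
      rcases hu.lt_or_gt with hu | hu
      · rw [if_pos (sub_pos.2 hu), indicator_of_mem (show u ∈ Iic x from hu.le), neg_mul,
          Real.exp_neg, Pi.one_apply]
        field_simp
      · rw [if_neg (by linarith), indicator_of_notMem (by simpa using hu), mul_zero]
  refine ((Complex.continuous_ofReal.tendsto _).comp hlim).congr' ?_
  filter_upwards [eventually_gt_atTop 0] with T hT
  rw [hformula T hT]
  rfl

/-! ### Convolution powers and the convolution exponential -/

theorem integrable_cexp_neg_mul_iff {A : Measure ℝ} {s : ℂ} :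
    Integrable (fun u : ℝ => Complex.exp (-s * u)) A ↔
      Integrable (fun u => Real.exp (-s.re * u)) A := by
  rw [← integrable_norm_iff (Continuous.aestronglyMeasurable (by fun_prop))]
  simp_rw [norm_exp_neg_mul]

theorem integrable_exp_conv {A B : Measure ℝ} [SFinite B] {c : ℝ}
    (hA : Integrable (fun u => Real.exp (-c * u)) A)
    (hB : Integrable (fun u => Real.exp (-c * u)) B) :
    Integrable (fun u => Real.exp (-c * u)) (A ∗ B) := by
  rw [integrable_conv_iff (Continuous.aestronglyMeasurable (by fun_prop))]
  simp_rw [mul_add, Real.exp_add]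
  refine ⟨ae_of_all _ fun x => hB.const_mul _, ?_⟩
  simp_rw [norm_mul, integral_const_mul]
  exact hA.norm.mul_const _

theorem laplace_conv {A B : Measure ℝ} [SFinite A] [SFinite B] {s : ℂ}
    (hA : Integrable (fun u => Real.exp (-s.re * u)) A)
    (hB : Integrable (fun u => Real.exp (-s.re * u)) B) :
    laplace (A ∗ B) s = laplace A s * laplace B s := by
  rw [laplace, integral_conv (integrable_cexp_neg_mul_iff.2 (integrable_exp_conv hA hB))]
  push_cast
  simp_rw [mul_add, Complex.exp_add, integral_const_mul, integral_mul_const]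
  rfl

/-- The iterated additive convolution of a measure with itself. -/
noncomputable def convPow (A : Measure ℝ) : ℕ → Measure ℝ
  | 0 => Measure.dirac 0
  | j + 1 => convPow A j ∗ A

instance (A : Measure ℝ) [SFinite A] (j : ℕ) : SFinite (convPow A j) := by
  induction j with
  | zero => rw [convPow]; infer_instance
  | succ j ih => rw [convPow]; infer_instance

theorem integrable_exp_convPow {A : Measure ℝ} [SFinite A] {c : ℝ}
    (hA : Integrable (fun u => Real.exp (-c * u)) A) (j : ℕ) :
    Integrable (fun u => Real.exp (-c * u)) (convPow A j) := by
  induction j with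
  | zero => exact integrable_dirac (by simp)
  | succ j ih => exact integrable_exp_conv ih hA

theorem laplace_convPow {A : Measure ℝ} [SFinite A] {s : ℂ}
    (hA : Integrable (fun u => Real.exp (-s.re * u)) A) (j : ℕ) :
    laplace (convPow A j) s = laplace A s ^ j := by
  induction j with
  | zero => simp [laplace, convPow]
  | succ j ih => rw [convPow, laplace_conv (integrable_exp_convPow hA j) hA, ih, pow_succ]

theorem laplace_ofReal (A : Measure ℝ) (c : ℝ) :
    laplace A c = ((∫ u, Real.exp (-c * u) ∂A : ℝ) : ℂ) := by
  rw [laplace, ← integral_complex_ofReal]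
  push_cast
  rfl

theorem laplace_smul (r : ℝ≥0∞) (A : Measure ℝ) (s : ℂ) :
    laplace (r • A) s = r.toReal * laplace A s := by
  rw [laplace, integral_smul_measure, Complex.real_smul, laplace]

/-- The exponential of a measure with respect to convolution. -/
noncomputable def convExp (A : Measure ℝ) : Measure ℝ :=
  Measure.sum fun j : ℕ => (j.factorial : ℝ≥0∞)⁻¹ • convPow A j

instance (A : Measure ℝ) [SFinite A] : SFinite (convExp A) := by
  rw [convExp]; infer_instance

theorem integrable_exp_convExp {A : Measure ℝ} [SFinite A] {c : ℝ}
    (hA : Integrable (fun u => Real.exp (-c * u)) A) :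
    Integrable (fun u => Real.exp (-c * u)) (convExp A) := by
  -- The integrand is positive, so summability of the norms reduces to the real exponential series.
  have hpow : ∀ j, ∫ u, Real.exp (-c * u) ∂(convPow A j) = (∫ u, Real.exp (-c * u) ∂A) ^ j := by
    intro j
    have h := laplace_convPow (s := (c : ℂ)) (by simpa using hA) j
    rw [laplace_ofReal, laplace_ofReal] at h
    exact_mod_cast h
  refine integrable_sum_measure (fun j => ?_) ?_
  · exact (integrable_exp_convPow hA j).smul_measure (by simp [Nat.factorial_ne_zero])
  · simp_rw [Real.norm_of_nonneg (Real.exp_pos _).le, integral_smul_measure, hpow]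
    refine (Real.summable_pow_div_factorial (∫ u, Real.exp (-c * u) ∂A)).congr fun j => ?_
    simp [div_eq_inv_mul]

theorem laplace_convExp {A : Measure ℝ} [SFinite A] {s : ℂ}
    (hA : Integrable (fun u => Real.exp (-s.re * u)) A) :
    laplace (convExp A) s = Complex.exp (laplace A s) := by
  have h1 := hasSum_integral_measure (integrable_cexp_neg_mul_iff.2 (integrable_exp_convExp hA))
  have h2 := NormedSpace.expSeries_div_hasSum_exp (laplace A s)
  rw [← Complex.exp_eq_exp_ℂ] at h2
  refine h1.unique (h2.congr_fun fun j => ?_)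
  have := laplace_smul (j.factorial : ℝ≥0∞)⁻¹ (convPow A j) s
  rw [laplace_convPow hA] at this
  rw [← laplace, this]
  simp [div_eq_inv_mul]

/-! ### Comparison of distribution functions under convolution -/

theorem conv_apply_eq_lintegral (A B : Measure ℝ) [SFinite B] {S : Set ℝ} (hS : MeasurableSet S) :
    (A ∗ B) S = ∫⁻ u, B ((fun v => u + v) ⁻¹' S) ∂A := by
  rw [Measure.conv, Measure.map_apply measurable_add hS,
    Measure.prod_apply (measurable_add hS)]
  rfl

theorem conv_Iic (A B : Measure ℝ) [SFinite B] (y : ℝ) :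
    (A ∗ B) (Iic y) = ∫⁻ u, B (Iic (y - u)) ∂A := by
  simp [conv_apply_eq_lintegral A B measurableSet_Iic]

theorem ae_not_neg_of_Iio_zero {A : Measure ℝ} (hA : A (Iio 0) = 0) : ∀ᵐ u ∂A, ¬ u < 0 := by
  rw [ae_iff]
  simp only [not_not]
  exact hA

theorem conv_Iio_zero {A B : Measure ℝ} [SFinite B] (hA : A (Iio 0) = 0) (hB : B (Iio 0) = 0) :
    (A ∗ B) (Iio 0) = 0 := by
  rw [conv_apply_eq_lintegral A B measurableSet_Iio, lintegral_eq_zero_iff']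
  · have hae := ae_not_neg_of_Iio_zero hA
    filter_upwards [hae] with u hu
    refine measure_mono_null (fun v hv => ?_) hB
    simp only [mem_preimage, mem_Iio] at hv ⊢
    linarith
  · exact (measurable_measure_prodMk_left (measurable_add measurableSet_Iio)).aemeasurable

theorem convPow_Iio_zero {A : Measure ℝ} [SFinite A] (hA : A (Iio 0) = 0) (j : ℕ) :
    convPow A j (Iio 0) = 0 := by
  induction j with
  | zero => simp [convPow]
  | succ j ih => exact conv_Iio_zero ih hA

/-- As `A` lives on the half-line, `y - u ≤ b` for almost every `u`, so a comparison known only up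
to `b` suffices. -/
theorem conv_Iic_mono_right {A B C : Measure ℝ} [SFinite B] [SFinite C] (hA : A (Iio 0) = 0)
    {b : ℝ} (h : ∀ y ≤ b, B (Iic y) ≤ C (Iic y)) : ∀ y ≤ b, (A ∗ B) (Iic y) ≤ (A ∗ C) (Iic y) := by
  intro y hy
  rw [conv_Iic, conv_Iic]
  have hae := ae_not_neg_of_Iio_zero hA
  refine lintegral_mono_ae ?_
  filter_upwards [hae] with u hu
  exact h _ (by linarith)

/-- Replace the last factor first, then commute the convolution and replace the remaining power by
induction. -/
theorem convPow_Iic_mono {A B : Measure ℝ} [SFinite A] [SFinite B] (hA : A (Iio 0) = 0)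
    (hB : B (Iio 0) = 0) {b : ℝ} (h : ∀ y ≤ b, A (Iic y) ≤ B (Iic y)) (j : ℕ) :
    ∀ y ≤ b, convPow A j (Iic y) ≤ convPow B j (Iic y) := by
  induction j with
  | zero => exact fun y _ => le_rfl
  | succ j ih =>
    intro y hy
    refine (conv_Iic_mono_right (convPow_Iio_zero hA j) h y hy).trans ?_
    rw [convPow, Measure.conv_comm, Measure.conv_comm (convPow B j)]
    exact conv_Iic_mono_right hB ih y hy

theorem convExp_apply (A : Measure ℝ) {S : Set ℝ} (hS : MeasurableSet S) :
    convExp A S = ∑' j : ℕ, (j.factorial : ℝ≥0∞)⁻¹ * convPow A j S := by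
  rw [convExp, Measure.sum_apply _ hS]
  rfl

/-- The convolution exponential is monotone for the pointwise order of distribution functions. -/
theorem convExp_Iic_mono {A B : Measure ℝ} [SFinite A] [SFinite B] (hA : A (Iio 0) = 0)
    (hB : B (Iio 0) = 0) {b : ℝ} (h : ∀ y ≤ b, A (Iic y) ≤ B (Iic y)) {y : ℝ} (hy : y ≤ b) :
    convExp A (Iic y) ≤ convExp B (Iic y) := by
  rw [convExp_apply _ measurableSet_Iic, convExp_apply _ measurableSet_Iic]
  exact ENNReal.tsum_le_tsum fun j => mul_le_mul_right (convPow_Iic_mono hA hB h j y hy) _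

/-- Convolving with an atomless measure leaves no atom, so only the zeroth power, the point mass at
`0`, has one. -/
theorem convExp_singleton {A : Measure ℝ} [SFinite A] (hA : ∀ y, A {y} = 0) {x : ℝ} (hx : x ≠ 0) :
    convExp A {x} = 0 := by
  rw [convExp_apply _ (measurableSet_singleton x), ENNReal.tsum_eq_zero]
  intro j
  cases j with
  | zero => simp [convPow, hx.symm]
  | succ j =>
    have h : ∀ u : ℝ, (fun v => u + v) ⁻¹' {x} = {x - u} := fun u => by
      ext v
      rw [mem_preimage, mem_singleton_iff, mem_singleton_iff, eq_sub_iff_add_eq']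
    simp [convPow, conv_apply_eq_lintegral _ A (measurableSet_singleton x), h, hA]

/-! ### Uniqueness of the Laplace transform, and a mass at the origin -/

/-- A measure is determined by the values of its Laplace transform on a vertical line. -/
theorem eq_of_laplace_eq {A B : Measure ℝ} {c : ℝ}
    (hA : Integrable (fun u => Real.exp (-c * u)) A)
    (hB : Integrable (fun u => Real.exp (-c * u)) B)
    (h : ∀ s : ℂ, s.re = c → laplace A s = laplace B s) : A = B := by
  -- With density `exp (-c u)` both measures become finite, and the Laplace transform on the line
  -- becomes a characteristic function. The density never vanishes, so it can be divided out at the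
  -- end.
  set f : ℝ → ℝ≥0∞ := fun u => ENNReal.ofReal (Real.exp (-c * u)) with hf
  have hfm : Measurable f := by fun_prop
  have hfin : ∀ {C : Measure ℝ}, Integrable (fun u => Real.exp (-c * u)) C →
      IsFiniteMeasure (C.withDensity f) := fun hC => isFiniteMeasure_withDensity_ofReal hC.2
  have hchar : ∀ (C : Measure ℝ) (t : ℝ),
      charFun (C.withDensity f) t = laplace C (c - t * Complex.I) := by
    intro C t
    rw [charFun_apply_real, laplace,
      show f = fun u => ((Real.exp (-c * u)).toNNReal : ℝ≥0∞) from rfl,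
      integral_withDensity_eq_integral_smul (f := fun u => (Real.exp (-c * u)).toNNReal)
        (by fun_prop)]
    refine integral_congr_ae (ae_of_all _ fun u => ?_)
    simp only [NNReal.smul_def, Real.coe_toNNReal _ (Real.exp_pos _).le]
    rw [Complex.real_smul, Complex.ofReal_exp, ← Complex.exp_add]
    congr 1
    push_cast
    ring
  have hfA := hfin hA
  have hfB := hfin hB
  have heq : A.withDensity f = B.withDensity f := by
    refine Measure.ext_of_charFun (funext fun t => ?_)
    rw [hchar, hchar, h _ (by simp)]
  have hinv : ∀ C : Measure ℝ, ((C.withDensity f).withDensity fun x => (f x)⁻¹) = C := fun C =>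
    withDensity_inv_same hfm (ae_of_all _ fun u => by simp [hf, Real.exp_pos])
      (ae_of_all _ fun u => ENNReal.ofReal_ne_top)
  rw [← hinv A, heq, hinv B]

theorem laplace_add {A B : Measure ℝ} {s : ℂ}
    (hA : Integrable (fun u => Real.exp (-s.re * u)) A)
    (hB : Integrable (fun u => Real.exp (-s.re * u)) B) :
    laplace (A + B) s = laplace A s + laplace B s :=
  integral_add_measure (integrable_cexp_neg_mul_iff.2 hA) (integrable_cexp_neg_mul_iff.2 hB)

theorem laplace_dirac (x : ℝ) (s : ℂ) : laplace (Measure.dirac x) s = Complex.exp (-s * x) := by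
  rw [laplace, integral_dirac]

/-- Adding a mass `r` at the origin multiplies the convolution exponential by `exp r`. -/
theorem convExp_add_dirac {A : Measure ℝ} [SFinite A] {c : ℝ}
    (hA : Integrable (fun u => Real.exp (-c * u)) A) {r : ℝ} (hr : 0 ≤ r) :
    convExp (A + ENNReal.ofReal r • Measure.dirac 0) =
      ENNReal.ofReal (Real.exp r) • convExp A := by
  have hD : Integrable (fun u => Real.exp (-c * u)) (ENNReal.ofReal r • Measure.dirac (0 : ℝ)) :=
    (integrable_dirac (by simp)).smul_measure ENNReal.ofReal_ne_top
  refine eq_of_laplace_eq (c := c) (integrable_exp_convExp (hA.add_measure hD))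
    ((integrable_exp_convExp hA).smul_measure ENNReal.ofReal_ne_top) ?_
  rintro s rfl
  rw [laplace_convExp (hA.add_measure hD), laplace_smul, laplace_convExp hA, laplace_add hA hD,
    laplace_smul, laplace_dirac, ENNReal.toReal_ofReal hr, ENNReal.toReal_ofReal (Real.exp_pos r).le]
  simp [Complex.exp_add, mul_comm]

/-! ### Generating function of restricted partitions -/

/-- The power series `F` converges absolutely at `z`, with sum `w`. -/
def PowerSeriesHasValue (F : PowerSeries ℂ) (z w : ℂ) : Prop :=
  (Summable fun n => ‖PowerSeries.coeff n F * z ^ n‖) ∧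
    HasSum (fun n => PowerSeries.coeff n F * z ^ n) w

theorem PowerSeriesHasValue.one (z : ℂ) : PowerSeriesHasValue 1 z 1 := by
  have h : ∀ n, n ≠ 0 → PowerSeries.coeff n (1 : PowerSeries ℂ) * z ^ n = 0 := fun n hn => by
    rw [PowerSeries.coeff_one, if_neg hn, zero_mul]
  refine ⟨summable_of_ne_finset_zero (s := {0}) fun n hn => ?_, ?_⟩
  · rw [h n (by simpa using hn), norm_zero]
  · simpa using hasSum_single 0 h

theorem PowerSeriesHasValue.mul {F G : PowerSeries ℂ} {z v w : ℂ}
    (hF : PowerSeriesHasValue F z v) (hG : PowerSeriesHasValue G z w) :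
    PowerSeriesHasValue (F * G) z (v * w) := by
  have hcoeff : ∀ n, PowerSeries.coeff n (F * G) * z ^ n =
      ∑ kl ∈ Finset.HasAntidiagonal.antidiagonal n,
        (PowerSeries.coeff kl.1 F * z ^ kl.1) * (PowerSeries.coeff kl.2 G * z ^ kl.2) := by
    intro n
    rw [PowerSeries.coeff_mul, Finset.sum_mul]
    refine Finset.sum_congr rfl fun kl hkl => ?_
    rw [← Finset.HasAntidiagonal.mem_antidiagonal.1 hkl, pow_add]
    ring
  have hs := summable_norm_sum_mul_antidiagonal_of_summable_norm hF.1 hG.1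
  simp_rw [← hcoeff] at hs
  refine ⟨hs, ?_⟩
  rw [← hF.2.tsum_eq, ← hG.2.tsum_eq,
    tsum_mul_tsum_eq_tsum_sum_antidiagonal_of_summable_norm hF.1 hG.1]
  simp_rw [← hcoeff]
  exact hs.of_norm.hasSum

theorem PowerSeriesHasValue.prod {ι : Type*} (I : Finset ι) {F : ι → PowerSeries ℂ} {z : ℂ}
    {w : ι → ℂ} (h : ∀ i ∈ I, PowerSeriesHasValue (F i) z (w i)) :
    PowerSeriesHasValue (∏ i ∈ I, F i) z (∏ i ∈ I, w i) := by
  induction I using Finset.cons_induction with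
  | empty => exact PowerSeriesHasValue.one z
  | cons a s ha ih =>
    rw [Finset.prod_cons, Finset.prod_cons]
    exact (h a (Finset.mem_cons_self a s)).mul (ih fun i hi => h i (Finset.mem_cons_of_mem hi))

open PowerSeries.WithPiTopology in
theorem tsum_X_pow_mul {m : ℕ} (hm : 0 < m) :
    ∑' j : ℕ, (PowerSeries.X : PowerSeries ℂ) ^ (m * j) =
      PowerSeries.mk fun n => if m ∣ n then 1 else 0 := by
  refine HasSum.tsum_eq ?_
  rw [hasSum_iff_hasSum_coeff]
  intro n
  simp_rw [PowerSeries.coeff_X_pow, PowerSeries.coeff_mk]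
  split_ifs with hn
  · obtain ⟨d, rfl⟩ := hn
    have h := hasSum_single (f := fun j => if m * d = m * j then (1 : ℂ) else 0) d fun j hj =>
      if_neg fun h => hj (Nat.eq_of_mul_eq_mul_left hm h).symm
    rwa [if_pos rfl] at h
  · have : ∀ j, ¬ n = m * j := fun j hj => hn ⟨j, hj⟩
    simp [this, hasSum_zero]

theorem powerSeriesHasValue_dvd {m : ℕ} (hm : 0 < m) {z : ℂ} (hz : ‖z‖ < 1) :
    PowerSeriesHasValue (PowerSeries.mk fun n => if m ∣ n then 1 else 0) z (1 - z ^ m)⁻¹ := by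
  constructor
  · refine Summable.of_nonneg_of_le (fun _ => norm_nonneg _) (fun n => ?_)
      (summable_geometric_of_lt_one (norm_nonneg z) hz)
    rw [PowerSeries.coeff_mk]
    split_ifs
    · simp
    · simp
  · have hinj : Function.Injective fun j : ℕ => m * j :=
      fun a b hab => Nat.eq_of_mul_eq_mul_left hm hab
    rw [← hinj.hasSum_iff]
    · have h := hasSum_geometric_of_norm_lt_one (ξ := z ^ m)
        (by rw [norm_pow]; exact pow_lt_one₀ (norm_nonneg z) hz hm.ne')
      refine h.congr_fun fun j => ?_
      simp [PowerSeries.coeff_mk, pow_mul]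
    · intro n hn
      rw [PowerSeries.coeff_mk, if_neg, zero_mul]
      rintro ⟨d, rfl⟩
      exact hn ⟨d, rfl⟩

open PowerSeries.WithPiTopology in
theorem mk_card_restricted_mem (I : Finset ℕ) (hI : 0 ∉ I) :
    (PowerSeries.mk fun n => ((Nat.Partition.restricted n (· ∈ I)).card : ℂ)) =
      ∏ m ∈ I, PowerSeries.mk fun n => if m ∣ n then 1 else 0 := by
  have h1 := Nat.Partition.hasProd_powerSeriesMk_card_restricted ℂ (· ∈ I)
  -- The infinite product is indexed so that factor `i` belongs to part size `i + 1`; hence the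
  -- reindexing by `Nat.pred`.
  have hinj : Set.InjOn Nat.pred I := fun a ha b hb hab =>
    Nat.pred_inj (Nat.pos_of_ne_zero fun h => hI (h ▸ ha))
      (Nat.pos_of_ne_zero fun h => hI (h ▸ hb)) hab
  have h2 := h1.unique (hasProd_prod_of_ne_finset_one (s := I.image Nat.pred) fun i hi => ?_)
  · rw [h2, Finset.prod_image hinj]
    refine Finset.prod_congr rfl fun m hm => ?_
    have hm0 : 0 < m := Nat.pos_of_ne_zero fun h => hI (h ▸ hm)
    rw [Nat.pred_eq_sub_one, Nat.sub_add_cancel hm0, if_pos hm, tsum_X_pow_mul hm0]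
  · exact if_neg fun hi' => hi (Finset.mem_image.2 ⟨i + 1, hi', rfl⟩)

/-! ### The partition measure and its convolution logarithm -/

instance sfinite_finsetSum {ι : Type*} (s : Finset ι) (A : ι → Measure ℝ) [∀ i, SFinite (A i)] :
    SFinite (∑ i ∈ s, A i) :=
  Finset.sum_induction A SFinite (fun _ _ _ _ => inferInstance) inferInstance
    fun _ _ => inferInstance

theorem laplace_finsetSum {ι : Type*} (I : Finset ι) {A : ι → Measure ℝ} {s : ℂ}
    (hA : ∀ i ∈ I, Integrable (fun u => Real.exp (-s.re * u)) (A i)) :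
    laplace (∑ i ∈ I, A i) s = ∑ i ∈ I, laplace (A i) s :=
  integral_finsetSum_measure fun i hi => integrable_cexp_neg_mul_iff.2 (hA i hi)

theorem laplace_sum_dirac {a : ℕ → ℝ≥0∞} (ha : ∀ n, a n ≠ ∞) {x : ℕ → ℝ} {s w : ℂ}
    (hs : Summable fun n => ‖(a n).toReal * Complex.exp (-s * x n)‖)
    (hw : HasSum (fun n => (a n).toReal * Complex.exp (-s * x n)) w) :
    Integrable (fun u => Real.exp (-s.re * u)) (Measure.sum fun n => a n • Measure.dirac (x n)) ∧
      laplace (Measure.sum fun n => a n • Measure.dirac (x n)) s = w := by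
  have hint : Integrable (fun u : ℝ => Complex.exp (-s * u))
      (Measure.sum fun n => a n • Measure.dirac (x n)) := by
    refine integrable_sum_dirac ha (hs.congr fun n => ?_)
    rw [norm_mul, Complex.norm_real, Real.norm_of_nonneg ENNReal.toReal_nonneg]
  refine ⟨integrable_cexp_neg_mul_iff.1 hint, ?_⟩
  refine (hasSum_integral_measure hint).unique (hw.congr_fun fun n => ?_)
  rw [← laplace, laplace_smul, laplace_dirac]

/-- The measure `∑ₙ p(n) δₙ` where `p(n)` is the number of partitions of `n` with parts in `I`. -/
noncomputable def partitionMeasure (I : Finset ℕ) : Measure ℝ :=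
  Measure.sum fun n : ℕ =>
    ((Nat.Partition.restricted n (· ∈ I)).card : ℝ≥0∞) • Measure.dirac (n : ℝ)

/-- The measure whose Laplace transform is `∑_{m ∈ I} -log (1 - exp (-s m))`. -/
noncomputable def logMeasure (I : Finset ℕ) : Measure ℝ :=
  ∑ m ∈ I, Measure.sum fun k : ℕ => ENNReal.ofReal (k : ℝ)⁻¹ • Measure.dirac ((k : ℝ) * m)

instance (I : Finset ℕ) : SFinite (logMeasure I) := by
  rw [logMeasure]; infer_instance

theorem norm_exp_neg_lt_one {s : ℂ} (hs : 0 < s.re) : ‖Complex.exp (-s)‖ < 1 := by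
  rw [Complex.norm_exp]
  simpa using hs

theorem laplace_partitionMeasure {I : Finset ℕ} (hI : 0 ∉ I) {s : ℂ} (hs : 0 < s.re) :
    Integrable (fun u => Real.exp (-s.re * u)) (partitionMeasure I) ∧
      laplace (partitionMeasure I) s = ∏ m ∈ I, (1 - Complex.exp (-s) ^ m)⁻¹ := by
  have h := PowerSeriesHasValue.prod I fun m hm =>
    powerSeriesHasValue_dvd (Nat.pos_of_ne_zero fun h => hI (h ▸ hm)) (norm_exp_neg_lt_one hs)
  rw [← mk_card_restricted_mem I hI] at h
  have hterm : ∀ n : ℕ, PowerSeries.coeff n (PowerSeries.mk fun n =>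
      ((Nat.Partition.restricted n (· ∈ I)).card : ℂ)) * Complex.exp (-s) ^ n =
      ((((Nat.Partition.restricted n (· ∈ I)).card : ℝ≥0∞).toReal : ℝ) : ℂ) *
        Complex.exp (-s * (n : ℝ)) := by
    intro n
    rw [PowerSeries.coeff_mk, ← Complex.exp_nat_mul, ENNReal.toReal_natCast]
    push_cast
    rw [mul_comm (-s)]
  unfold PowerSeriesHasValue at h
  simp_rw [hterm] at h
  exact laplace_sum_dirac (fun n => ENNReal.natCast_ne_top _) h.1 h.2

theorem laplace_sum_inv_dirac {m : ℕ} (hm : 0 < m) {s : ℂ} (hs : 0 < s.re) :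
    Integrable (fun u => Real.exp (-s.re * u)) (Measure.sum fun k : ℕ =>
        ENNReal.ofReal (k : ℝ)⁻¹ • Measure.dirac ((k : ℝ) * m)) ∧
      laplace (Measure.sum fun k : ℕ =>
        ENNReal.ofReal (k : ℝ)⁻¹ • Measure.dirac ((k : ℝ) * m)) s =
        -Complex.log (1 - Complex.exp (-s) ^ m) := by
  have hz : ‖Complex.exp (-s) ^ m‖ < 1 := by
    rw [norm_pow]
    exact pow_lt_one₀ (norm_nonneg _) (norm_exp_neg_lt_one hs) hm.ne'
  have hterm : ∀ k : ℕ, (Complex.exp (-s) ^ m) ^ k / k =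
      ((ENNReal.ofReal (k : ℝ)⁻¹).toReal : ℂ) * Complex.exp (-s * ((k : ℝ) * m : ℝ)) := by
    intro k
    rw [← pow_mul, ← Complex.exp_nat_mul, ENNReal.toReal_ofReal (by positivity), div_eq_inv_mul]
    push_cast
    congr 2
    ring
  have h := Complex.hasSum_taylorSeries_neg_log hz
  have hsum : Summable fun k : ℕ => ‖(Complex.exp (-s) ^ m) ^ k / k‖ := by
    refine Summable.of_nonneg_of_le (fun _ => norm_nonneg _) (fun k => ?_)
      (summable_geometric_of_lt_one (norm_nonneg _) hz)
    rw [norm_div, norm_pow, Complex.norm_natCast]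
    rcases Nat.eq_zero_or_pos k with rfl | hk
    · simp
    · exact div_le_self (by positivity) (by exact_mod_cast hk)
  simp_rw [hterm] at h hsum
  exact laplace_sum_dirac (fun _ => ENNReal.ofReal_ne_top) hsum h

theorem integrable_exp_logMeasure {I : Finset ℕ} (hI : 0 ∉ I) {s : ℂ} (hs : 0 < s.re) :
    Integrable (fun u => Real.exp (-s.re * u)) (logMeasure I) :=
  integrable_finsetSum_measure.2 fun _ hm =>
    (laplace_sum_inv_dirac (Nat.pos_of_ne_zero fun h => hI (h ▸ hm)) hs).1

/-- With `z = exp (-s)`, both sides have Laplace transform `∏ (1 - z ^ m)⁻¹`, the left one by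
exponentiating `∑ -log (1 - z ^ m)`. The abscissa `1` is an arbitrary positive choice. -/
theorem convExp_logMeasure {I : Finset ℕ} (hI : 0 ∉ I) :
    convExp (logMeasure I) = partitionMeasure I := by
  have hpos : ∀ m ∈ I, 0 < m := fun m hm => Nat.pos_of_ne_zero fun h => hI (h ▸ hm)
  have h1 : (0 : ℝ) < (1 : ℂ).re := by simp
  refine eq_of_laplace_eq (c := (1 : ℂ).re) (integrable_exp_convExp (integrable_exp_logMeasure hI h1))
    (laplace_partitionMeasure hI h1).1 fun s hs => ?_
  rw [← hs] at h1
  rw [laplace_convExp (integrable_exp_logMeasure hI h1), (laplace_partitionMeasure hI h1).2,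
    logMeasure, laplace_finsetSum I fun m hm => (laplace_sum_inv_dirac (hpos m hm) h1).1,
    Complex.exp_sum]
  refine Finset.prod_congr rfl fun m hm => ?_
  rw [(laplace_sum_inv_dirac (hpos m hm) h1).2, Complex.exp_neg, Complex.exp_log]
  intro h0
  have : ‖Complex.exp (-s) ^ m‖ < 1 := by
    rw [norm_pow]
    exact pow_lt_one₀ (norm_nonneg _) (norm_exp_neg_lt_one h1) (hpos m hm).ne'
  rw [← sub_eq_zero.1 h0, norm_one] at this
  exact lt_irrefl _ this

theorem partitionMeasure_Iic (I : Finset ℕ) (N : ℕ) :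
    partitionMeasure I (Iic (N : ℝ)) =
      ∑ n ∈ Finset.range (N + 1), ((Nat.Partition.restricted n (· ∈ I)).card : ℝ≥0∞) := by
  rw [partitionMeasure, Measure.sum_apply _ measurableSet_Iic,
    tsum_eq_sum (s := Finset.range (N + 1))]
  · refine Finset.sum_congr rfl fun n hn => ?_
    have : n ≤ N := Nat.lt_succ_iff.1 (Finset.mem_range.1 hn)
    simp [this]
  · intro n hn
    have : N < n := by simpa [Nat.lt_succ_iff] using hn
    simp [this]

theorem logMeasure_Iio_zero (I : Finset ℕ) : logMeasure I (Iio 0) = 0 := by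
  rw [logMeasure, Measure.finsetSum_apply]
  refine Finset.sum_eq_zero fun m _ => ?_
  rw [Measure.sum_apply _ measurableSet_Iio, ENNReal.tsum_eq_zero]
  intro k
  have : ¬ ((k : ℝ) * m < 0) := not_lt.2 (by positivity)
  simp [this]

/-- Below `N` only the multiples `k * m` with `k ≤ N` matter, since `m ≥ 1`. This matches the
cut-off at `N` in `lambdaSum`. -/
theorem logMeasure_Iic {I : Finset ℕ} (hI : 0 ∉ I) {N : ℕ} {y : ℝ} (hy : y ≤ N) :
    logMeasure I (Iic y) = ∑ k ∈ Finset.Icc 1 N,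
      ENNReal.ofReal (k : ℝ)⁻¹ * ((I.filter fun m : ℕ => (k : ℝ) * m ≤ y).card : ℝ≥0∞) := by
  rw [logMeasure, Measure.finsetSum_apply]
  have h : ∀ m ∈ I, (Measure.sum fun k : ℕ =>
      ENNReal.ofReal (k : ℝ)⁻¹ • Measure.dirac ((k : ℝ) * m)) (Iic y) =
      ∑ k ∈ Finset.Icc 1 N, ENNReal.ofReal (k : ℝ)⁻¹ * if (k : ℝ) * m ≤ y then 1 else 0 := by
    intro m hm
    rw [Measure.sum_apply _ measurableSet_Iic, tsum_eq_sum (s := Finset.Icc 1 N)]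
    · refine Finset.sum_congr rfl fun k _ => ?_
      simp [indicator_apply]
    · intro k hk
      -- The term `k = 0` has weight `0⁻¹ = 0`.
      rcases Nat.eq_zero_or_pos k with rfl | hk0
      · simp
      · have hNk : N < k := by
          by_contra hle
          exact hk (Finset.mem_Icc.2 ⟨hk0, not_lt.1 hle⟩)
        have hm0 : 1 ≤ m := Nat.pos_of_ne_zero fun h => hI (h ▸ hm)
        have h1 : (N : ℝ) < k := by exact_mod_cast hNk
        have h2 : (1 : ℝ) ≤ m := by exact_mod_cast hm0
        have : ¬ ((k : ℝ) * m ≤ y) := by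
          have := le_mul_of_one_le_right (Nat.cast_nonneg (α := ℝ) k) h2
          linarith
        simp [this]
  rw [Finset.sum_congr rfl h, Finset.sum_comm]
  refine Finset.sum_congr rfl fun k _ => ?_
  rw [← Finset.mul_sum, Finset.sum_boole]

/-! ### The measure behind `λ` -/

/-- The measure `∑_{k ≤ N} (1/k) (k h)_* dx` on the half-line, with Laplace transform `λ`. -/
noncomputable def stepMeasure (h : ℝ → ℝ) (N : ℕ) : Measure ℝ :=
  ∑ k ∈ Finset.Icc 1 N,
    ENNReal.ofReal (k : ℝ)⁻¹ • (volume.restrict (Ioi (0 : ℝ))).map fun x => (k : ℝ) * h x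

instance (h : ℝ → ℝ) (N : ℕ) : SFinite (stepMeasure h N) := by
  rw [stepMeasure]; infer_instance

section

variable {h : ℝ → ℝ}

theorem exists_natCast_eq (hmono : StrictMonoOn h (Ici 0)) (hzero : h 0 = 0)
    (hint : ∀ n : ℕ, ∃ m : ℤ, h n = m) :
    ∃ H : ℕ → ℕ, StrictMono H ∧ H 0 = 0 ∧ ∀ n : ℕ, h n = H n := by
  have hnonneg : ∀ n : ℕ, 0 ≤ h n := fun n => by
    rw [← hzero]
    exact hmono.monotoneOn self_mem_Ici (mem_Ici.2 n.cast_nonneg) n.cast_nonneg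
  have hnat : ∀ n : ℕ, ∃ m : ℕ, h n = m := fun n => by
    obtain ⟨m, hm⟩ := hint n
    have h0 : 0 ≤ m := by
      have := hnonneg n
      rw [hm] at this
      exact_mod_cast this
    lift m to ℕ using h0
    exact ⟨m, by simpa using hm⟩
  choose H hH using hnat
  refine ⟨H, fun a b hab => ?_, ?_, hH⟩
  · have := hmono (mem_Ici.2 a.cast_nonneg) (mem_Ici.2 b.cast_nonneg)
      (Nat.cast_lt (α := ℝ).2 hab)
    rw [hH, hH] at this
    exact_mod_cast this
  · have := hH 0
    rw [Nat.cast_zero, hzero] at this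
    exact_mod_cast this.symm

/-- A strictly increasing sequence of naturals satisfies `n ≤ H n`. This linear growth makes the
Laplace integrals converge for every positive abscissa. -/
theorem sub_one_le_apply (hmono : StrictMonoOn h (Ici 0)) (hzero : h 0 = 0)
    (hint : ∀ n : ℕ, ∃ m : ℤ, h n = m) {x : ℝ} (hx : 0 < x) : x - 1 ≤ h x := by
  obtain ⟨H, hH, -, hh⟩ := exists_natCast_eq hmono hzero hint
  have h1 : h ⌊x⌋₊ ≤ h x := hmono.monotoneOn (mem_Ici.2 (Nat.cast_nonneg _)) (mem_Ici.2 hx.le)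
    (Nat.floor_le hx.le)
  have h2 : (⌊x⌋₊ : ℝ) ≤ H ⌊x⌋₊ := by exact_mod_cast hH.le_apply
  rw [hh] at h1
  linarith [Nat.lt_floor_add_one x]

theorem aemeasurable_const_mul (hmono : StrictMonoOn h (Ici 0)) (k : ℝ) :
    AEMeasurable (fun x => k * h x) (volume.restrict (Ioi (0 : ℝ))) :=
  (aemeasurable_restrict_of_monotoneOn measurableSet_Ioi
    (hmono.monotoneOn.mono Ioi_subset_Ici_self)).const_mul k

theorem integrable_exp_map (hmono : StrictMonoOn h (Ici 0)) (hzero : h 0 = 0)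
    (hint : ∀ n : ℕ, ∃ m : ℤ, h n = m) {k : ℝ} (hk : 0 < k) {c : ℝ} (hc : 0 < c) :
    Integrable (fun u => Real.exp (-c * u))
      ((volume.restrict (Ioi (0 : ℝ))).map fun x => k * h x) := by
  have hm := aemeasurable_const_mul hmono k
  rw [integrable_map_measure (Continuous.aestronglyMeasurable (by fun_prop)) hm]
  refine Integrable.mono' ((exp_neg_integrableOn_Ioi 0 (mul_pos hc hk)).const_mul
    (Real.exp (c * k))) ?_ ?_
  · exact (Real.measurable_exp.comp_aemeasurable (hm.const_mul (-c))).aestronglyMeasurable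
  · refine (ae_restrict_iff' measurableSet_Ioi).2 (ae_of_all _ fun x hx => ?_)
    rw [Function.comp_apply, Real.norm_of_nonneg (Real.exp_pos _).le, ← Real.exp_add,
      Real.exp_le_exp]
    have := mul_le_mul_of_nonneg_left (sub_one_le_apply hmono hzero hint hx) (mul_pos hc hk).le
    linarith

theorem integrable_exp_stepMeasure (hmono : StrictMonoOn h (Ici 0)) (hzero : h 0 = 0)
    (hint : ∀ n : ℕ, ∃ m : ℤ, h n = m) (N : ℕ) {c : ℝ} (hc : 0 < c) :
    Integrable (fun u => Real.exp (-c * u)) (stepMeasure h N) :=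
  integrable_finsetSum_measure.2 fun _ hk => (integrable_exp_map hmono hzero hint
    (Nat.cast_pos.2 (Finset.mem_Icc.1 hk).1) hc).smul_measure ENNReal.ofReal_ne_top

theorem laplace_stepMeasure (hmono : StrictMonoOn h (Ici 0)) (hzero : h 0 = 0)
    (hint : ∀ n : ℕ, ∃ m : ℤ, h n = m) (N : ℕ) {s : ℂ} (hs : 0 < s.re) :
    laplace (stepMeasure h N) s = lambdaSum h N s := by
  rw [stepMeasure, laplace_finsetSum, lambdaSum]
  · refine Finset.sum_congr rfl fun k hk => ?_
    rw [laplace_smul, ENNReal.toReal_ofReal (by positivity), laplace, integral_map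
      (aemeasurable_const_mul hmono k) (Continuous.aestronglyMeasurable (by fun_prop)), wPrime,
      div_eq_inv_mul]
    push_cast
    simp_rw [mul_assoc]
  · exact fun k hk => (integrable_exp_map hmono hzero hint
      (Nat.cast_pos.2 (Finset.mem_Icc.1 hk).1) hs).smul_measure ENNReal.ofReal_ne_top

theorem stepMeasure_apply (hmono : StrictMonoOn h (Ici 0)) (N : ℕ) {S : Set ℝ}
    (hS : MeasurableSet S) :
    stepMeasure h N S = ∑ k ∈ Finset.Icc 1 N,
      ENNReal.ofReal (k : ℝ)⁻¹ * volume {x | (k : ℝ) * h x ∈ S ∧ 0 < x} := by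
  rw [stepMeasure, Measure.finsetSum_apply]
  refine Finset.sum_congr rfl fun k _ => ?_
  rw [Measure.smul_apply, smul_eq_mul,
    Measure.map_apply_of_aemeasurable (aemeasurable_const_mul hmono k) hS,
    Measure.restrict_apply₀' measurableSet_Ioi.nullMeasurableSet]
  rfl

/-- By strict monotonicity a level set of `k * h` on the half-line has at most one point. -/
theorem stepMeasure_singleton (hmono : StrictMonoOn h (Ici 0)) (N : ℕ) (y : ℝ) :
    stepMeasure h N {y} = 0 := by
  rw [stepMeasure_apply hmono N (measurableSet_singleton y)]
  refine Finset.sum_eq_zero fun k hk => ?_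
  have hk0 : (k : ℝ) ≠ 0 := Nat.cast_ne_zero.2 (Nat.one_le_iff_ne_zero.1 (Finset.mem_Icc.1 hk).1)
  have hsub : {x | (k : ℝ) * h x ∈ ({y} : Set ℝ) ∧ 0 < x}.Subsingleton := by
    rintro a ⟨ha, ha0⟩ b ⟨hb, hb0⟩
    exact hmono.injOn (mem_Ici.2 ha0.le) (mem_Ici.2 hb0.le)
      (mul_left_cancel₀ hk0 (ha.trans hb.symm))
  rw [hsub.measure_zero, mul_zero]

theorem stepMeasure_Iio_zero (hmono : StrictMonoOn h (Ici 0)) (hzero : h 0 = 0) (N : ℕ) :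
    stepMeasure h N (Iio 0) = 0 := by
  rw [stepMeasure_apply hmono N measurableSet_Iio]
  refine Finset.sum_eq_zero fun k hk => ?_
  have : {x | (k : ℝ) * h x ∈ Iio (0 : ℝ) ∧ 0 < x} = ∅ := by
    refine eq_empty_of_forall_notMem fun x hx => ?_
    have h0 : h 0 < h x := hmono self_mem_Ici (mem_Ici.2 hx.2.le) hx.2
    rw [hzero] at h0
    have : 0 ≤ (k : ℝ) * h x := by positivity
    exact absurd hx.1 (not_lt.2 this)
  rw [this, measure_empty, mul_zero]

/-! ### Counting parts against lengths of sublevel sets -/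

open scoped Classical in
/-- The values `h i` with `i ≥ 1` that are at most `N`. -/
noncomputable def admissibleParts (h : ℝ → ℝ) (N : ℕ) : Finset ℕ :=
  (Finset.Icc 1 N).filter fun m => ∃ i : ℕ, 1 ≤ i ∧ h i = (m : ℝ)

theorem zero_notMem_admissibleParts (N : ℕ) : 0 ∉ admissibleParts h N := by
  simp [admissibleParts]

theorem restricted_congr {n : ℕ} {p q : ℕ → Prop} [DecidablePred p] [DecidablePred q]
    (hpq : ∀ m, 1 ≤ m → m ≤ n → (p m ↔ q m)) :
    Nat.Partition.restricted n p = Nat.Partition.restricted n q :=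
  Finset.filter_congr fun x _ => forall₂_congr fun m hm =>
    hpq m (x.parts_pos hm) (Nat.Partition.le_of_mem_parts hm)

theorem partitionCount_eq_card {n N : ℕ} (hn : n ≤ N) :
    partitionCount h n = (Nat.Partition.restricted n (· ∈ admissibleParts h N)).card := by
  classical
  rw [partitionCount]
  refine congrArg Finset.card (restricted_congr fun m h1 h2 => ?_)
  simp [admissibleParts, h1, h2.trans hn]

/-- The number of values `h i ≤ t` and the length of `{x > 0 | h x ≤ t}` differ by at most one. -/
theorem volume_sublevel_bounds (hmono : StrictMonoOn h (Ici 0)) (hzero : h 0 = 0)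
    (hint : ∀ n : ℕ, ∃ m : ℤ, h n = m) {N : ℕ} {t : ℝ} (ht : t ≤ N) :
    (((admissibleParts h N).filter fun m : ℕ => (m : ℝ) ≤ t).card : ℝ≥0∞) ≤
        volume {x | h x ≤ t ∧ 0 < x} ∧
      volume {x | h x ≤ t ∧ 0 < x} ≤
        (((admissibleParts h N).filter fun m : ℕ => (m : ℝ) ≤ t).card : ℝ≥0∞) + 1 := by
  classical
  obtain ⟨H, hH, hH0, hh⟩ := exists_natCast_eq hmono hzero hint
  rcases lt_or_ge t 0 with ht0 | ht0
  · have h1 : (admissibleParts h N).filter (fun m : ℕ => (m : ℝ) ≤ t) = ∅ := by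
      refine Finset.filter_eq_empty_iff.2 fun m _ hm => ?_
      linarith [Nat.cast_nonneg (α := ℝ) m]
    have h2 : {x | h x ≤ t ∧ 0 < x} = ∅ := by
      refine eq_empty_of_forall_notMem fun x hx => ?_
      have h0 : h 0 < h x := hmono self_mem_Ici (mem_Ici.2 hx.2.le) hx.2
      linarith [hx.1]
    simp [h1, h2]
  -- `n` is the last index with `H n ≤ t`; searching up to `N` is enough because `i ≤ H i` and `t ≤
  -- N`. The sublevel set then lies between `Ioc 0 n` and `Ioc 0 (n + 1)`.
  · set n := Nat.findGreatest (fun i => (H i : ℝ) ≤ t) N with hn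
    have hle : (H n : ℝ) ≤ t :=
      Nat.findGreatest_spec (P := fun i => (H i : ℝ) ≤ t) (Nat.zero_le N) (by simpa [hH0] using ht0)
    have hgt : t < H (n + 1) := by
      by_contra! hcon
      have h3 : ((n + 1 : ℕ) : ℝ) ≤ N := by
        have h4 : ((n + 1 : ℕ) : ℝ) ≤ H (n + 1) := by exact_mod_cast hH.le_apply
        linarith
      have h5 : n + 1 ≤ n :=
        Nat.le_findGreatest (P := fun i => (H i : ℝ) ≤ t) (by exact_mod_cast h3) hcon
      omega
    have hcard : ((admissibleParts h N).filter fun m : ℕ => (m : ℝ) ≤ t) =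
        (Finset.Icc 1 n).image H := by
      ext m
      simp only [admissibleParts, Finset.mem_filter, Finset.mem_Icc, Finset.mem_image]
      constructor
      · rintro ⟨⟨-, i, hi, him⟩, hmt⟩
        rw [hh] at him
        refine ⟨i, ⟨hi, ?_⟩, by exact_mod_cast him⟩
        rw [← him] at hmt
        have : H i < H (n + 1) := by exact_mod_cast hmt.trans_lt hgt
        have := hH.lt_iff_lt.1 this
        omega
      · rintro ⟨i, ⟨hi1, hin⟩, rfl⟩
        have h1 : (H i : ℝ) ≤ t := le_trans (by exact_mod_cast hH.monotone hin) hle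
        refine ⟨⟨⟨hi1.trans hH.le_apply, ?_⟩, i, hi1, hh i⟩, h1⟩
        exact_mod_cast h1.trans ht
    rw [hcard, Finset.card_image_of_injective _ hH.injective, Nat.card_Icc, Nat.add_sub_cancel]
    constructor
    · have hsub : Ioc (0 : ℝ) n ⊆ {x | h x ≤ t ∧ 0 < x} := fun x hx => by
        refine ⟨le_trans (hmono.monotoneOn (mem_Ici.2 hx.1.le) (mem_Ici.2 n.cast_nonneg) hx.2) ?_,
          hx.1⟩
        rwa [hh]
      simpa using measure_mono (μ := volume) hsub
    · have hsub : {x | h x ≤ t ∧ 0 < x} ⊆ Ioc (0 : ℝ) (n + 1 : ℕ) := fun x hx => by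
        refine ⟨hx.2, ?_⟩
        by_contra! hcon
        have := hmono.monotoneOn (mem_Ici.2 (Nat.cast_nonneg _)) (mem_Ici.2 hx.2.le) hcon.le
        rw [hh] at this
        linarith [hx.1]
      have := measure_mono (μ := volume) hsub
      rw [Real.volume_Ioc, sub_zero, ENNReal.ofReal_natCast] at this
      exact_mod_cast this

/-- Apply `volume_sublevel_bounds` at `y / k` with weight `1 / k`. The errors, at most one for each
`k`, add up to the harmonic sum, which the mass at `0` absorbs. -/
theorem stepMeasure_Iic_bounds (hmono : StrictMonoOn h (Ici 0)) (hzero : h 0 = 0)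
    (hint : ∀ n : ℕ, ∃ m : ℤ, h n = m) {N : ℕ} {y : ℝ} (hy : y ≤ N) :
    logMeasure (admissibleParts h N) (Iic y) ≤ stepMeasure h N (Iic y) ∧
      stepMeasure h N (Iic y) ≤ (logMeasure (admissibleParts h N) +
        ENNReal.ofReal (∑ k ∈ Finset.Icc 1 N, (k : ℝ)⁻¹) • Measure.dirac 0 : Measure ℝ) (Iic y) := by
  have hkey : ∀ k ∈ Finset.Icc 1 N,
      (((admissibleParts h N).filter fun m : ℕ => (k : ℝ) * m ≤ y).card : ℝ≥0∞) ≤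
        volume {x | (k : ℝ) * h x ∈ Iic y ∧ 0 < x} ∧
      volume {x | (k : ℝ) * h x ∈ Iic y ∧ 0 < x} ≤
        (((admissibleParts h N).filter fun m : ℕ => (k : ℝ) * m ≤ y).card : ℝ≥0∞) + 1 := by
    intro k hk
    have hk1 : (1 : ℝ) ≤ k := by exact_mod_cast (Finset.mem_Icc.1 hk).1
    have hk0 : (0 : ℝ) < k := by linarith
    have hyk : y / k ≤ N := by
      rw [div_le_iff₀ hk0]
      exact hy.trans (le_mul_of_one_le_right N.cast_nonneg hk1)
    have := volume_sublevel_bounds hmono hzero hint hyk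
    simpa only [le_div_iff₀' hk0, mem_Iic] using this
  have hstep := stepMeasure_apply hmono N (measurableSet_Iic (a := y))
  have hlog := logMeasure_Iic (zero_notMem_admissibleParts (h := h) N) hy
  constructor
  · rw [hstep, hlog]
    exact Finset.sum_le_sum fun k hk => mul_le_mul_right (hkey k hk).1 _
  -- For `y < 0` the mass at `0` does not help, but the left side vanishes.
  · rcases lt_or_ge y 0 with hy0 | hy0
    · have : stepMeasure h N (Iic y) = 0 :=
        measure_mono_null (fun x hx => lt_of_le_of_lt hx hy0) (stepMeasure_Iio_zero hmono hzero N)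
      rw [this]
      exact zero_le
    · rw [Measure.add_apply, Measure.smul_apply, Measure.dirac_apply' _ measurableSet_Iic,
        indicator_of_mem (mem_Iic.2 hy0), Pi.one_apply, smul_eq_mul, mul_one, hstep, hlog,
        ENNReal.ofReal_sum_of_nonneg fun k _ => by positivity, ← Finset.sum_add_distrib]
      refine Finset.sum_le_sum fun k hk => ?_
      refine (mul_le_mul_right (hkey k hk).2 _).trans (le_of_eq ?_)
      rw [mul_add, mul_one]

/-! ### Bounds for the convolution exponential and the conclusion -/

theorem exp_sum_inv_le {N : ℕ} (hN : 0 < N) :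
    Real.exp (∑ k ∈ Finset.Icc 1 N, (k : ℝ)⁻¹) ≤ Real.exp 1 * N := by
  have h1 : (0 : ℝ) < N := Nat.cast_pos.2 hN
  have h2 := harmonic_le_one_add_log N
  rw [harmonic_eq_sum_Icc] at h2
  push_cast at h2
  calc Real.exp (∑ k ∈ Finset.Icc 1 N, (k : ℝ)⁻¹) ≤ Real.exp (1 + Real.log N) :=
        Real.exp_le_exp.2 h2
    _ = Real.exp 1 * N := by rw [Real.exp_add, Real.exp_log h1]

theorem convExp_stepMeasure_Iic_bounds (hmono : StrictMonoOn h (Ici 0)) (hzero : h 0 = 0)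
    (hint : ∀ n : ℕ, ∃ m : ℤ, h n = m) {N : ℕ} (hN : 0 < N) :
    (∑ n ∈ Finset.range (N + 1), (partitionCount h n : ℝ≥0∞)) ≤
        convExp (stepMeasure h N) (Iic (N : ℝ)) ∧
      convExp (stepMeasure h N) (Iic (N : ℝ)) ≤ ENNReal.ofReal (Real.exp 1 * N) *
        ∑ n ∈ Finset.range (N + 1), (partitionCount h n : ℝ≥0∞) := by
  have hI := zero_notMem_admissibleParts (h := h) N
  have hstep0 := stepMeasure_Iio_zero hmono hzero N
  have hlog0 := logMeasure_Iio_zero (admissibleParts h N)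
  have hsum : (∑ n ∈ Finset.range (N + 1), (partitionCount h n : ℝ≥0∞)) =
      convExp (logMeasure (admissibleParts h N)) (Iic (N : ℝ)) := by
    rw [convExp_logMeasure hI, partitionMeasure_Iic]
    refine Finset.sum_congr rfl fun n hn => ?_
    rw [partitionCount_eq_card (Nat.lt_succ_iff.1 (Finset.mem_range.1 hn))]
  have hbound := fun y (hy : y ≤ (N : ℝ)) => stepMeasure_Iic_bounds hmono hzero hint hy
  rw [hsum]
  refine ⟨convExp_Iic_mono hlog0 hstep0 (fun y hy => (hbound y hy).1) le_rfl, ?_⟩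
  refine (convExp_Iic_mono hstep0 (by simp [hlog0]) (fun y hy => (hbound y hy).2) le_rfl).trans ?_
  rw [convExp_add_dirac (c := (1 : ℂ).re) (integrable_exp_logMeasure hI (by simp))
    (Finset.sum_nonneg fun k _ => by positivity), Measure.smul_apply, smul_eq_mul]
  exact mul_le_mul_left (ENNReal.ofReal_le_ofReal (exp_sum_inv_le hN)) _

theorem tendsto_bromwichTrunc (hmono : StrictMonoOn h (Ici 0)) (hzero : h 0 = 0)
    (hint : ∀ n : ℕ, ∃ m : ℤ, h n = m) (N : ℕ) {x : ℝ} (hx : 0 < x) {c : ℝ} (hc : 0 < c) :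
    Tendsto (fun T : ℝ => bromwichTrunc h N c x T) atTop
      (𝓝 (((convExp (stepMeasure h N)).real (Iic x) : ℝ) : ℂ)) := by
  refine (tendsto_verticalIntegral_laplace _ hc
    (integrable_exp_convExp (integrable_exp_stepMeasure hmono hzero hint N hc))
    (convExp_singleton (stepMeasure_singleton hmono N) hx.ne')).congr fun T => ?_
  simp only [bromwichTrunc, verticalIntegral]
  congr 1
  refine intervalIntegral.integral_congr fun t _ => ?_
  have hre : ((c : ℂ) + t * Complex.I).re = c := by simp
  rw [laplace_convExp (integrable_exp_stepMeasure hmono hzero hint N (by rwa [hre])),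
    laplace_stepMeasure hmono hzero hint N (by rwa [hre])]

end

theorem mainTheorem3 (h : ℝ → ℝ) (hmono : StrictMonoOn h (Set.Ici 0)) (hzero : h 0 = 0)
    (hint : ∀ n : ℕ, ∃ m : ℤ, h n = m)
    (N : ℕ) (hN : 0 < N) (c : ℝ) (hc : 0 < c)
    (hbound : ∃ α D : ℝ, 0 < α ∧ 0 < D ∧
      ∀ s : ℂ, s.re = c → ‖wPrime h 1 s‖ ≤ D * ‖s‖ ^ (-α)) :
    ∃ φ : ℝ → ℝ,
      (∀ x : ℝ, 0 < x → ∀ c' : ℝ, 0 < c' →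
        Filter.Tendsto (fun T : ℝ => bromwichTrunc h N c' x T) Filter.atTop
          (nhds ((φ x : ℝ) : ℂ))) ∧
      Real.exp (-1) * (N : ℝ)⁻¹ * φ N ≤ ∑ n ∈ Finset.range (N + 1), (partitionCount h n : ℝ) ∧
      ∑ n ∈ Finset.range (N + 1), (partitionCount h n : ℝ) ≤ φ N := by
  refine ⟨fun x => (convExp (stepMeasure h N)).real (Iic x),
    fun x hx c' hc' => tendsto_bromwichTrunc hmono hzero hint N hx hc', ?_, ?_⟩
  all_goals
    obtain ⟨hlow, hupp⟩ := convExp_stepMeasure_Iic_bounds hmono hzero hint hN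
    have hsum : (∑ n ∈ Finset.range (N + 1), (partitionCount h n : ℝ≥0∞)) =
        ENNReal.ofReal (∑ n ∈ Finset.range (N + 1), (partitionCount h n : ℝ)) := by
      rw [ENNReal.ofReal_sum_of_nonneg fun n _ => by positivity]
      simp
    rw [hsum] at hlow hupp
    rw [← ENNReal.ofReal_mul (by positivity)] at hupp
  · have h1 : (convExp (stepMeasure h N)).real (Iic (N : ℝ)) ≤
        Real.exp 1 * N * ∑ n ∈ Finset.range (N + 1), (partitionCount h n : ℝ) :=
      ENNReal.toReal_le_of_le_ofReal (by positivity) hupp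
    have hN0 : (0 : ℝ) < N := Nat.cast_pos.2 hN
    rw [Real.exp_neg, ← mul_inv, inv_mul_le_iff₀ (by positivity)]
    exact h1
  -- The upper bound also shows that the mass is finite, so passing to `Measure.real` loses nothing.
  · exact (ENNReal.ofReal_le_iff_le_toReal (hupp.trans_lt ENNReal.ofReal_lt_top).ne).1 hlow
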